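/- Let $G=(V,E)$ be a finite directed graph with real edge capacities $c_{ij}$ and linear edge costs $f_{ij}\in\mathbb R$ for $(i,j)\in E$. Let $S\subseteq V$ be a set of source nodes with storage costs $d_i\ge 0$ ($i\in S$), let $T\subseteq V$ be a nonempty set of terminals, and let $h$ be the entropy of the original source. Let $G^*=(V^*,E^*)$ be obtained from $G$ by adding a node $s^*$ and an edge $(s^*,i)$ for every $i\in S$; put $c^*_{ij}=c_{ij}$ on $E$ and $c^*_{s^*i}=\infty$. For $t\in T$ let $\sigma^{(t)}_{s^*}=h$, $\sigma^{(t)}_t=-h$, and $\sigma^{(t)}_i=0$ otherwise. The flow constraints on real variables $x^{(t)}_{ij},z_{ij}$ are $$0\le x^{(t)}_{ij}\le z_{ij}\le c^*_{ij}\quad((i,j)\in E^*,\ t\in T),\qquad \sum_{j:(i,j)\in E^*}x^{(t)}_{ij}-\sum_{j:(j,i)\in E^*}x^{(t)}_{ji}=\sigma^{(t)}_i\quad(i\in V^*,\ t\in T).\tag{F}$$ CODED-MIN-COST is the problem of minimizing $\sum_{(i,j)\in E}f_{ij}z_{ij}+\sum_{i\in S}d_iz_{s^*i}$ over all $x,z$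 satisfying (F). SUBSET-MIN-COST has in addition real variables $R^{(t)}_i$ ($i\in S$, $t\in T$) and one real variable $\mu^*(A)$ for each nonempty atom $A$ of the field generated by sets $\widetilde X_i$, $i\in S$, in general position (the atoms $\bigcap_{i\in B}\widetilde X_i\cap\bigcap_{i\in S\setminus B}\widetilde X_i^{\,c}$ with $\emptyset\ne B\subseteq S$). Let $\mathcal A$ be the set of these atoms, $\widetilde X_U=\bigcup_{i\in U}\widetilde X_i$, $H(X_i)=\sum_{A\in\mathcal A,\,A\subseteq\widetilde X_i}\mu^*(A)$ and $H(X_U|X_{S\setminus U})=\sum_{A\in\mathcal A,\,A\not\subseteq\widetilde X_{S\setminus U}}\mu^*(A)$. The problem is to minimize $$\sum_{(i,j)\in E}f_{ij}z_{ij}+\sum_{A\in\mathcal A}\Big(\sum_{i\in S:\,A\subseteq\widetilde X_i}d_i\Big)\mu^*(A)$$ subject to (F), $x^{(t)}_{s^*i}\ge R^{(t)}_i$ for $i\in S$ and $t\in T$, $\sum_{i\in U}R^{(t)}_i\ge H(X_U|X_{S\setminus U})$ for $U\subseteq S$ and $t\in T$, $\mu^*(A)\ge 0$ for $A\in\mathcal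 A$, $z_{s^*i}=H(X_i)$ for $i\in S$, and $\sum_{A\in\mathcal A}\mu^*(A)=h$. Suppose that there are two source nodes, $|S|=2$. Let $f_{opt2}$ be the optimal value of SUBSET-MIN-COST and $f_{opt1}$ the optimal value of CODED-MIN-COST (each being $+\infty$ if the problem is infeasible). Then $f_{opt2}=f_{opt1}$. Moreover, one problem is feasible if and only if the other is, and in that case both minima are attained. -/

import Mathlib

/-- The data of a content distribution problem: a finite directed graph with vertex set `V`, edge
set `E`, capacities `cap` and linear flow costs `f` on the edges, a set `S` of source nodes with
linear storage costs `d`, a set `T` of terminals, and the entropy `h` of the original source,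
i.e. the joint entropy of the sources. Values of `cap`, `f` off `E` and of `d` off `S` are never
used. -/
structure DistributionNetwork (V : Type*) where
  E : Finset (V × V)
  cap : V × V → ℝ
  S : Finset V
  T : Finset V
  f : V × V → ℝ
  d : V → ℝ
  h : ℝ

namespace DistributionNetwork

variable {V : Type*} [DecidableEq V] (N : DistributionNetwork V)

/-- The edges of the augmented graph `G*`: its vertices are `Option V`, where `none` is the virtual
super node `s*`. The edges are those of `G`, together with an edge `(s*, i)` for each source
`i`. -/
def augEdges : Finset (Option V × Option V) :=
  N.E.image (fun e => (some e.1, some e.2)) ∪ N.S.image (fun i => (none, some i))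

/-- The capacities of the augmented graph: those of `G`, and infinity on the virtual edges. -/
noncomputable def augCap : Option V × Option V → EReal
  | (some u, some v) => (N.cap (u, v) : EReal)
  | _ => ⊤

/-- The supply `σ_i^{(t)}`: `h` at `s*`, `-h` at the terminal `t`, and `0` at other vertices. -/
def supply (t : V) (i : Option V) : ℝ :=
  if i = none then N.h else if i = some t then -N.h else 0

/-- The flow constraints common to both problems: for each terminal `t`, `x t` is a flow of value
`h` from `s*` to `t` in the augmented graph, and `z` dominates all these flows and respects the
capacities. -/
def IsMulticastFlow (x : V → Option V × Option V → ℝ) (z : Option V × Option V → ℝ) : Prop :=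
  (∀ e ∈ N.augEdges, ∀ t ∈ N.T, 0 ≤ x t e ∧ x t e ≤ z e ∧ (z e : EReal) ≤ N.augCap e) ∧
  (∀ i : Option V, ∀ t ∈ N.T,
    ∑ e ∈ N.augEdges with e.1 = i, x t e - ∑ e ∈ N.augEdges with e.2 = i, x t e = N.supply t i)

/-- The flow cost `∑_{(i,j) ∈ E} f_{ij} z_{ij}`. -/
def flowCost (z : Option V × Option V → ℝ) : ℝ :=
  ∑ e ∈ N.E, N.f e * z (some e.1, some e.2)

/-- The nonempty atoms of the field generated by the sets `X̃_i`, `i ∈ S`. The atom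
`⋂_{i ∈ A} X̃_i ∩ ⋂_{i ∈ S \ A} X̃_iᶜ` is represented by the nonempty set `A ⊆ S`. Thus the atom is
contained in `X̃_i` iff `i ∈ A`, and it is contained in `X̃_U = ⋃_{i ∈ U} X̃_i` iff `A` meets
`U`. -/
def atoms : Finset (Finset V) := N.S.powerset.filter Finset.Nonempty

/-- `H(X_i)`, the sum of the measures of the atoms contained in `X̃_i`. -/
def entropy (μ : Finset V → ℝ) (i : V) : ℝ := ∑ A ∈ N.atoms with i ∈ A, μ A

/-- `H(X_1, …, X_n)`, the sum of the measures of all nonempty atoms. -/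
def jointEntropy (μ : Finset V → ℝ) : ℝ := ∑ A ∈ N.atoms, μ A

/-- `H(X_U | X_{S \ U})`, the sum of the measures of the atoms not contained in `X̃_{S \ U}`. -/
def condEntropy (μ : Finset V → ℝ) (U : Finset V) : ℝ :=
  ∑ A ∈ N.atoms with Disjoint A (N.S \ U), μ A

/-- Membership of the rate vector `R` in the Slepian-Wolf region of the sources. -/
def InSlepianWolf (μ : Finset V → ℝ) (R : V → ℝ) : Prop :=
  ∀ U ⊆ N.S, N.condEntropy μ U ≤ ∑ i ∈ U, R i

/-- The constraints of SUBSET-MIN-COST, in the variables `x`, `z`, `R` and the atom measures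
`μ`. -/
def SubsetFeasible (x : V → Option V × Option V → ℝ) (z : Option V × Option V → ℝ)
    (R : V → V → ℝ) (μ : Finset V → ℝ) : Prop :=
  N.IsMulticastFlow x z ∧
  (∀ i ∈ N.S, ∀ t ∈ N.T, R t i ≤ x t (none, some i)) ∧
  (∀ t ∈ N.T, N.InSlepianWolf μ (R t)) ∧
  (∀ A ∈ N.atoms, 0 ≤ μ A) ∧
  (∀ i ∈ N.S, z (none, some i) = N.entropy μ i) ∧
  N.h = N.jointEntropy μ

/-- The objective of SUBSET-MIN-COST. -/
def subsetCost (z : Option V × Option V → ℝ) (μ : Finset V → ℝ) : ℝ :=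
  N.flowCost z + ∑ A ∈ N.atoms, (∑ i ∈ N.S with i ∈ A, N.d i) * μ A

/-- The objective of CODED-MIN-COST. -/
def codedCost (z : Option V × Option V → ℝ) : ℝ :=
  N.flowCost z + ∑ i ∈ N.S, N.d i * z (none, some i)

/-- The objective values of the feasible points of SUBSET-MIN-COST. -/
def subsetValues : Set ℝ :=
  {c | ∃ x z R μ, N.SubsetFeasible x z R μ ∧ N.subsetCost z μ = c}

/-- The objective values of the feasible points of CODED-MIN-COST. -/
def codedValues : Set ℝ :=
  {c | ∃ x z, N.IsMulticastFlow x z ∧ N.codedCost z = c}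

/-- The optimal value of SUBSET-MIN-COST (`⊤` if the problem is infeasible). -/
noncomputable def subsetMinCost : EReal := sInf ((fun c : ℝ => (c : EReal)) '' N.subsetValues)

/-- The optimal value of CODED-MIN-COST (`⊤` if the problem is infeasible). -/
noncomputable def codedMinCost : EReal := sInf ((fun c : ℝ => (c : EReal)) '' N.codedValues)

end DistributionNetwork

/-!
A point feasible for SUBSET-MIN-COST is feasible for CODED-MIN-COST at the same cost. Conversely,
the flow to each terminal leaves `s*` through the virtual edges with total value `h`, so lowering
each stored amount `z_{s*i}` to at most `h` preserves feasibility and, as `d ≥ 0`, does not raise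
the cost. For two sources `a` and `b` this leaves `z_{s*a}, z_{s*b} ≤ h ≤ z_{s*a} + z_{s*b}`, which
is exactly what makes `h - z_{s*b}`, `h - z_{s*a}` and `z_{s*a} + z_{s*b} - h` nonnegative masses
for the atoms `{a}`, `{b}` and `{a, b}`, with marginals `z_{s*i}`. The rates `R_i = x_{s*i}` then
satisfy the Slepian-Wolf inequalities because they add up to `h` and `x_{s*i} ≤ z_{s*i}`.

Bounding the remaining variables by the capacities makes the feasible set compact, so the minimum is
attained.
-/

namespace DistributionNetwork

variable {V : Type*} {N : DistributionNetwork V}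

/-- The largest value that a flow or a dominating vector needs on each edge of `G*`: the capacity on
an edge of `G`, and `h` on a virtual edge. The absolute value keeps the bound nonnegative at pairs
outside `E`, where `cap` is arbitrary. -/
def edgeBound (N : DistributionNetwork V) : Option V × Option V → ℝ
  | (some u, some v) => |N.cap (u, v)|
  | _ => N.h

theorem edgeBound_nonneg (hh : 0 ≤ N.h) : 0 ≤ N.edgeBound
  | (some _, some _) => abs_nonneg _
  | (some _, none) => hh
  | (none, _) => hh

theorem continuous_codedCost (N : DistributionNetwork V) : Continuous N.codedCost := by
  unfold codedCost flowCost
  fun_prop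

variable [DecidableEq V]
  {x x' : V → Option V × Option V → ℝ} {z z' : Option V × Option V → ℝ} {t : V}

@[simp]
theorem some_some_mem_augEdges {u v : V} : (some u, some v) ∈ N.augEdges ↔ (u, v) ∈ N.E := by
  simp [augEdges]

@[simp]
theorem none_some_mem_augEdges {i : V} : (none, some i) ∈ N.augEdges ↔ i ∈ N.S := by
  simp [augEdges]

@[simp]
theorem mk_none_notMem_augEdges {u : Option V} : (u, none) ∉ N.augEdges := by
  simp [augEdges]

theorem filter_augEdges_fst_eq_none (N : DistributionNetwork V) :
    N.augEdges.filter (fun e => e.1 = none) = N.S.image (fun i => (none, some i)) := by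
  ext ⟨_ | u, _ | v⟩ <;> simp

theorem filter_augEdges_snd_eq_none (N : DistributionNetwork V) :
    N.augEdges.filter (fun e => e.2 = none) = ∅ := by
  ext ⟨u, _ | v⟩ <;> simp

theorem IsMulticastFlow.congr (hf : N.IsMulticastFlow x z)
    (hx : ∀ t ∈ N.T, ∀ e ∈ N.augEdges, x' t e = x t e) (hz : ∀ e ∈ N.augEdges, z' e = z e) :
    N.IsMulticastFlow x' z' := by
  refine ⟨fun e he t ht => ?_, fun i t ht => ?_⟩
  · rw [hx t ht e he, hz e he]
    exact hf.1 e he t ht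
  · rw [← hf.2 i t ht]
    congr 1 <;> exact Finset.sum_congr rfl fun e he => hx t ht e (Finset.mem_filter.1 he).1

theorem codedCost_congr (hz : ∀ e ∈ N.augEdges, z' e = z e) : N.codedCost z' = N.codedCost z := by
  unfold codedCost flowCost
  congr 1
  · exact Finset.sum_congr rfl fun e he => by rw [hz _ (some_some_mem_augEdges.2 he)]
  · exact Finset.sum_congr rfl fun i hi => by rw [hz _ (none_some_mem_augEdges.2 hi)]

theorem IsMulticastFlow.sum_source_flow (hf : N.IsMulticastFlow x z) (ht : t ∈ N.T) :
    ∑ i ∈ N.S, x t (none, some i) = N.h := by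
  have hbalance := hf.2 none t ht
  rw [filter_augEdges_fst_eq_none, filter_augEdges_snd_eq_none,
    Finset.sum_image fun i _ j _ hij => by simpa using hij] at hbalance
  simpa [supply] using hbalance

theorem IsMulticastFlow.source_flow_nonneg (hf : N.IsMulticastFlow x z) (ht : t ∈ N.T) {i : V}
    (hi : i ∈ N.S) : 0 ≤ x t (none, some i) :=
  (hf.1 _ (none_some_mem_augEdges.2 hi) t ht).1

theorem IsMulticastFlow.source_flow_le_storage (hf : N.IsMulticastFlow x z) (ht : t ∈ N.T) {i : V}
    (hi : i ∈ N.S) : x t (none, some i) ≤ z (none, some i) :=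
  (hf.1 _ (none_some_mem_augEdges.2 hi) t ht).2.1

theorem IsMulticastFlow.source_flow_le_h (hf : N.IsMulticastFlow x z) (ht : t ∈ N.T) {i : V}
    (hi : i ∈ N.S) : x t (none, some i) ≤ N.h :=
  hf.sum_source_flow ht ▸ Finset.single_le_sum (f := fun i => x t (none, some i))
    (fun _ hj => hf.source_flow_nonneg ht hj) hi

theorem IsMulticastFlow.h_nonneg (hf : N.IsMulticastFlow x z) (hT : N.T.Nonempty) : 0 ≤ N.h := by
  obtain ⟨t, ht⟩ := hT
  exact hf.sum_source_flow ht ▸ Finset.sum_nonneg fun _ hi => hf.source_flow_nonneg ht hi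

theorem IsMulticastFlow.le_cap (hf : N.IsMulticastFlow x z) (hT : N.T.Nonempty) {e : V × V}
    (he : e ∈ N.E) : z (some e.1, some e.2) ≤ N.cap e := by
  obtain ⟨t, ht⟩ := hT
  exact EReal.coe_le_coe_iff.1 (hf.1 _ (some_some_mem_augEdges.2 he) t ht).2.2

theorem IsMulticastFlow.le_edgeBound (hf : N.IsMulticastFlow x z) (ht : t ∈ N.T)
    {e : Option V × Option V} (he : e ∈ N.augEdges) : x t e ≤ N.edgeBound e := by
  rcases e with ⟨_ | u, _ | v⟩
  · simp at he
  · exact hf.source_flow_le_h ht (none_some_mem_augEdges.1 he)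
  · simp at he
  · exact (hf.1 _ he t ht).2.1.trans
      ((hf.le_cap ⟨t, ht⟩ (some_some_mem_augEdges.1 he)).trans (le_abs_self _))

theorem IsMulticastFlow.inf_edgeBound (hf : N.IsMulticastFlow x z) :
    N.IsMulticastFlow x (z ⊓ N.edgeBound) := by
  refine ⟨fun e he t ht => ?_, hf.2⟩
  obtain ⟨hx_nonneg, hxz, hz_cap⟩ := hf.1 e he t ht
  exact ⟨hx_nonneg, le_min hxz (hf.le_edgeBound ht he),
    (EReal.coe_le_coe_iff.2 (min_le_left _ _)).trans hz_cap⟩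

theorem IsMulticastFlow.codedCost_inf_edgeBound_le (hf : N.IsMulticastFlow x z)
    (hT : N.T.Nonempty) (hd : ∀ i ∈ N.S, 0 ≤ N.d i) :
    N.codedCost (z ⊓ N.edgeBound) ≤ N.codedCost z := by
  refine add_le_add (Finset.sum_le_sum fun e he => ?_) (Finset.sum_le_sum fun i hi => ?_)
  · have h_eq : (z ⊓ N.edgeBound) (some e.1, some e.2) = z (some e.1, some e.2) :=
      min_eq_left ((hf.le_cap hT he).trans (le_abs_self _))
    rw [h_eq]
  · exact mul_le_mul_of_nonneg_left (min_le_left _ _) (hd i hi)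

theorem IsMulticastFlow.exists_mem_Icc_edgeBound (hf : N.IsMulticastFlow x z) (hT : N.T.Nonempty)
    (hd : ∀ i ∈ N.S, 0 ≤ N.d i) :
    ∃ p ∈ Set.Icc 0 (fun _ : V => N.edgeBound, N.edgeBound),
      N.IsMulticastFlow p.1 p.2 ∧ N.codedCost p.2 ≤ N.codedCost z := by
  have h_bound := edgeBound_nonneg (hf.h_nonneg hT)
  set x₀ : V → Option V × Option V → ℝ :=
    fun t e => if t ∈ N.T ∧ e ∈ N.augEdges then x t e else 0
  set z₀ : Option V × Option V → ℝ :=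
    fun e => if e ∈ N.augEdges then (z ⊓ N.edgeBound) e else 0
  have hz₀_eq : ∀ e ∈ N.augEdges, z₀ e = (z ⊓ N.edgeBound) e := fun e he => if_pos he
  have hf₀ : N.IsMulticastFlow x₀ z₀ :=
    hf.inf_edgeBound.congr (fun t ht e he => if_pos ⟨ht, he⟩) hz₀_eq
  refine ⟨(x₀, z₀), ⟨⟨fun t e => ?_, fun e => ?_⟩, ⟨fun t e => ?_, fun e => ?_⟩⟩, hf₀,
    (codedCost_congr hz₀_eq).trans_le (hf.codedCost_inf_edgeBound_le hT hd)⟩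
  · by_cases hte : t ∈ N.T ∧ e ∈ N.augEdges
    · exact (hf₀.1 e hte.2 t hte.1).1
    · exact (if_neg hte).ge
  · by_cases he : e ∈ N.augEdges
    · obtain ⟨t, ht⟩ := hT
      exact (hf₀.1 e he t ht).1.trans (hf₀.1 e he t ht).2.1
    · exact (if_neg he).ge
  · by_cases hte : t ∈ N.T ∧ e ∈ N.augEdges
    · exact hf₀.le_edgeBound hte.1 hte.2
    · exact (if_neg hte).trans_le (h_bound e)
  · by_cases he : e ∈ N.augEdges
    · exact (hz₀_eq e he).trans_le (min_le_right _ _)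
    · exact (if_neg he).trans_le (h_bound e)

theorem isClosed_setOf_isMulticastFlow (N : DistributionNetwork V) :
    IsClosed {p : (V → Option V × Option V → ℝ) × (Option V × Option V → ℝ) |
      N.IsMulticastFlow p.1 p.2} := by
  simp only [IsMulticastFlow, Set.ofPred_and, Set.ofPred_forall]
  refine .inter (isClosed_iInter fun e => isClosed_iInter fun _ => isClosed_iInter fun t =>
    isClosed_iInter fun _ => ?_) (isClosed_iInter fun i => isClosed_iInter fun t =>
    isClosed_iInter fun _ => isClosed_eq (by fun_prop) continuous_const)
  exact (isClosed_le (by fun_prop) (by fun_prop)).inter <|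
    (isClosed_le (by fun_prop) (by fun_prop)).inter <|
      isClosed_le (continuous_coe_real_ereal.comp (by fun_prop)) continuous_const

theorem exists_isLeast_codedValues (hT : N.T.Nonempty) (hd : ∀ i ∈ N.S, 0 ≤ N.d i)
    (hne : N.codedValues.Nonempty) : ∃ c, IsLeast N.codedValues c := by
  set K := Set.Icc 0 (fun _ : V => N.edgeBound, N.edgeBound) ∩ {p | N.IsMulticastFlow p.1 p.2}
  have hK : IsCompact ((fun p => N.codedCost p.2) '' K) :=
    (isCompact_Icc.inter_right N.isClosed_setOf_isMulticastFlow).image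
      (N.continuous_codedCost.comp continuous_snd)
  have h_sub : (fun p => N.codedCost p.2) '' K ⊆ N.codedValues := by
    rintro _ ⟨p, hp, rfl⟩
    exact ⟨p.1, p.2, hp.2, rfl⟩
  have h_coinitial : IsCoinitialFor N.codedValues ((fun p => N.codedCost p.2) '' K) := by
    rintro _ ⟨x, z, hf, rfl⟩
    obtain ⟨p, hp, hfp, h_cost⟩ := hf.exists_mem_Icc_edgeBound hT hd
    exact ⟨_, ⟨p, ⟨hp, hfp⟩, rfl⟩, h_cost⟩
  obtain ⟨c, hc_mem, hc_le⟩ := hK.exists_isLeast (h_coinitial.nonempty hne)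
  exact ⟨c, h_sub hc_mem, lowerBounds_mono_of_isCoinitialFor h_coinitial hc_le⟩

theorem sum_atoms_storageCost (N : DistributionNetwork V) (μ : Finset V → ℝ) :
    ∑ A ∈ N.atoms, (∑ i ∈ N.S with i ∈ A, N.d i) * μ A = ∑ i ∈ N.S, N.d i * N.entropy μ i := by
  simp only [entropy, Finset.sum_mul, Finset.mul_sum, Finset.sum_filter]
  rw [Finset.sum_comm]
  simp only [ite_mul, mul_ite, zero_mul, mul_zero]

theorem SubsetFeasible.subsetCost_eq_codedCost {R : V → V → ℝ} {μ : Finset V → ℝ}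
    (h : N.SubsetFeasible x z R μ) : N.subsetCost z μ = N.codedCost z := by
  obtain ⟨-, -, -, -, h_marginal, -⟩ := h
  rw [subsetCost, codedCost, sum_atoms_storageCost]
  congr 1
  exact Finset.sum_congr rfl fun i hi => by rw [h_marginal i hi]

theorem subsetValues_subset_codedValues (N : DistributionNetwork V) :
    N.subsetValues ⊆ N.codedValues := by
  rintro _ ⟨x, z, R, μ, h, rfl⟩
  exact ⟨x, z, h.1, h.subsetCost_eq_codedCost.symm⟩

/-- The measure with total mass `h` and marginals `w i` in which any two sources together determine
everything: the atom `S \ {i}` carries the mass `h - w i` that source `i` lacks, and the atom `S`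
carries the rest. For `S = {a, b}` the atoms `{a}`, `{b}`, `{a, b}` have masses `h - w b`,
`h - w a`, `w a + w b - h`. -/
def erasureMeasure (N : DistributionNetwork V) (w : V → ℝ) (A : Finset V) : ℝ :=
  (∑ i ∈ N.S, if A = N.S.erase i then N.h - w i else 0) +
    if A = N.S then N.h - ∑ i ∈ N.S, (N.h - w i) else 0

variable {w : V → ℝ}

theorem erasureMeasure_nonneg (hw : ∀ i ∈ N.S, w i ≤ N.h)
    (h_sum : ∑ i ∈ N.S, (N.h - w i) ≤ N.h) (A : Finset V) : 0 ≤ N.erasureMeasure w A := by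
  refine add_nonneg (Finset.sum_nonneg fun i hi => ?_) ?_
  · split_ifs
    exacts [sub_nonneg.2 (hw i hi), le_rfl]
  · split_ifs
    exacts [sub_nonneg.2 h_sum, le_rfl]

theorem sum_filter_atoms_erasureMeasure (hS : N.S.Nontrivial) (w : V → ℝ) (p : Finset V → Prop)
    [DecidablePred p] :
    ∑ A ∈ N.atoms with p A, N.erasureMeasure w A =
      ∑ i ∈ N.S with p (N.S.erase i), (N.h - w i) +
        if p N.S then N.h - ∑ i ∈ N.S, (N.h - w i) else 0 := by
  have h_erase : ∀ i ∈ N.S, N.S.erase i ∈ N.atoms := fun i hi => by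
    simpa [atoms, Finset.erase_subset] using (Finset.erase_nonempty hi).2 hS
  have h_full : N.S ∈ N.atoms := by simpa [atoms] using hS.nonempty
  simp only [erasureMeasure, Finset.sum_add_distrib, Finset.sum_ite_eq', Finset.mem_filter,
    h_full, true_and]
  rw [Finset.sum_comm, Finset.sum_filter]
  congr 1
  refine Finset.sum_congr rfl fun i hi => ?_
  simp only [Finset.sum_ite_eq', Finset.mem_filter, h_erase i hi, true_and]

theorem jointEntropy_erasureMeasure (hS : N.S.Nontrivial) (w : V → ℝ) :
    N.jointEntropy (N.erasureMeasure w) = N.h := by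
  simpa [jointEntropy] using sum_filter_atoms_erasureMeasure hS w fun _ => True

theorem entropy_erasureMeasure (hS : N.S.Nontrivial) (w : V → ℝ) {j : V} (hj : j ∈ N.S) :
    N.entropy (N.erasureMeasure w) j = w j := by
  have h_filter : N.S.filter (fun i => j ∈ N.S.erase i) = N.S.erase j := by
    ext i
    simp [hj, and_comm, eq_comm]
  rw [entropy, sum_filter_atoms_erasureMeasure hS, h_filter, if_pos hj,
    Finset.sum_erase_eq_sub hj]
  ring

theorem condEntropy_erasureMeasure_self (hS : N.S.Nontrivial) (w : V → ℝ) :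
    N.condEntropy (N.erasureMeasure w) N.S = N.h := by
  simpa [condEntropy, jointEntropy] using jointEntropy_erasureMeasure hS w

theorem condEntropy_erasureMeasure_of_sdiff_eq_singleton (hS : N.S.Nontrivial) (w : V → ℝ)
    {U : Finset V} {j : V} (hU : N.S \ U = {j}) :
    N.condEntropy (N.erasureMeasure w) U = N.h - w j := by
  have hj : j ∈ N.S := Finset.sdiff_subset (hU ▸ Finset.mem_singleton_self j)
  simp [condEntropy, sum_filter_atoms_erasureMeasure hS, hU, hj, Finset.filter_eq]

theorem condEntropy_erasureMeasure_of_sdiff_nontrivial (hS : N.S.Nontrivial) (w : V → ℝ)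
    {U : Finset V} (hU : (N.S \ U).Nontrivial) : N.condEntropy (N.erasureMeasure w) U = 0 := by
  have h_erase : ∀ i, ¬Disjoint (N.S.erase i) (N.S \ U) := fun i => by
    obtain ⟨k, hk, hki⟩ := hU.exists_ne i
    exact Finset.not_disjoint_iff.2
      ⟨k, Finset.mem_erase.2 ⟨hki, Finset.sdiff_subset hk⟩, hk⟩
  have h_full : ¬Disjoint N.S (N.S \ U) := fun h =>
    hU.nonempty.ne_empty (disjoint_self.1 (h.mono_left Finset.sdiff_subset))
  simp only [condEntropy, sum_filter_atoms_erasureMeasure hS, h_erase, h_full, Finset.filter_false,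
    Finset.sum_empty, if_false, add_zero]

theorem inSlepianWolf_erasureMeasure (hS : N.S.Nontrivial) {R : V → ℝ}
    (hR_nonneg : ∀ i ∈ N.S, 0 ≤ R i) (hR_le : ∀ i ∈ N.S, R i ≤ w i)
    (hR_sum : ∑ i ∈ N.S, R i = N.h) : N.InSlepianWolf (N.erasureMeasure w) R := by
  intro U hU
  have h_split := Finset.sum_sdiff (f := R) hU
  rcases (N.S \ U).eq_empty_or_nonempty with h_empty | ⟨j, hj⟩
  · obtain rfl : U = N.S := hU.antisymm (Finset.sdiff_eq_empty_iff_subset.1 h_empty)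
    rw [condEntropy_erasureMeasure_self hS, hR_sum]
  · rcases Finset.eq_singleton_or_nontrivial hj with h_single | h_nontrivial
    · rw [condEntropy_erasureMeasure_of_sdiff_eq_singleton hS w h_single]
      rw [h_single, Finset.sum_singleton] at h_split
      linarith [hR_le j (Finset.sdiff_subset hj)]
    · rw [condEntropy_erasureMeasure_of_sdiff_nontrivial hS w h_nontrivial]
      exact Finset.sum_nonneg fun i hi => hR_nonneg i (hU hi)

theorem IsMulticastFlow.subsetFeasible_erasureMeasure (hf : N.IsMulticastFlow x z)
    (hS : N.S.Nontrivial) (hz : ∀ i ∈ N.S, z (none, some i) ≤ N.h)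
    (hz_sum : ∑ i ∈ N.S, (N.h - z (none, some i)) ≤ N.h) :
    N.SubsetFeasible x z (fun t i => x t (none, some i))
      (N.erasureMeasure fun i => z (none, some i)) :=
  ⟨hf, fun _ _ _ _ => le_rfl,
    fun _ ht => inSlepianWolf_erasureMeasure hS (fun _ => hf.source_flow_nonneg ht)
      (fun _ => hf.source_flow_le_storage ht) (hf.sum_source_flow ht),
    fun A _ => erasureMeasure_nonneg hz hz_sum A,
    fun _ hi => (entropy_erasureMeasure hS (fun i => z (none, some i)) hi).symm,
    (jointEntropy_erasureMeasure hS _).symm⟩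

theorem IsMulticastFlow.sum_h_sub_storage_le (hf : N.IsMulticastFlow x z) (hT : N.T.Nonempty) :
    ∑ i ∈ N.S, (N.h - z (none, some i)) ≤ (N.S.card - 1) * N.h := by
  obtain ⟨t, ht⟩ := hT
  calc ∑ i ∈ N.S, (N.h - z (none, some i))
      ≤ ∑ i ∈ N.S, (N.h - x t (none, some i)) :=
        Finset.sum_le_sum fun i hi => sub_le_sub_left (hf.source_flow_le_storage ht hi) _
    _ = (N.S.card - 1) * N.h := by
        rw [Finset.sum_sub_distrib, hf.sum_source_flow ht, Finset.sum_const, nsmul_eq_mul]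
        ring

theorem isCoinitialFor_codedValues_subsetValues (hS : N.S.card = 2) (hT : N.T.Nonempty)
    (hd : ∀ i ∈ N.S, 0 ≤ N.d i) : IsCoinitialFor N.codedValues N.subsetValues := by
  rintro _ ⟨x, z, hf, rfl⟩
  have hS_nontrivial : N.S.Nontrivial := Finset.one_lt_card_iff_nontrivial.1 (hS ▸ one_lt_two)
  have hf' := hf.inf_edgeBound
  have h_sum : ∑ i ∈ N.S, (N.h - (z ⊓ N.edgeBound) (none, some i)) ≤ N.h :=
    (hf'.sum_h_sub_storage_le hT).trans_eq (by rw [hS]; ring)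
  have h_feasible :=
    hf'.subsetFeasible_erasureMeasure hS_nontrivial (fun _ _ => inf_le_right) h_sum
  exact ⟨_, ⟨_, _, _, _, h_feasible, rfl⟩,
    h_feasible.subsetCost_eq_codedCost.trans_le (hf.codedCost_inf_edgeBound_le hT hd)⟩

end DistributionNetwork

theorem mainTheorem2_general {V : Type*} [DecidableEq V] (N : DistributionNetwork V)
    (hS : N.S.card = 2) (hT : N.T.Nonempty) (hd : ∀ i ∈ N.S, 0 ≤ N.d i) :
    N.subsetMinCost = N.codedMinCost ∧
    (N.subsetValues.Nonempty ↔ N.codedValues.Nonempty) ∧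
    (N.codedValues.Nonempty →
      ∃ fopt : ℝ, IsLeast N.subsetValues fopt ∧ IsLeast N.codedValues fopt) := by
  have h_sub := N.subsetValues_subset_codedValues
  have h_coinitial := DistributionNetwork.isCoinitialFor_codedValues_subsetValues hS hT hd
  refine ⟨le_antisymm ?_ (sInf_le_sInf (Set.image_mono h_sub)),
    ⟨fun h => h.mono h_sub, h_coinitial.nonempty⟩, fun h => ?_⟩
  · exact sInf_le_sInf_of_isCoinitialFor
      (h_coinitial.image_of_monotone EReal.coe_strictMono.monotone)
  · obtain ⟨c, hc⟩ := DistributionNetwork.exists_isLeast_codedValues hT hd h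
    obtain ⟨c', hc', hle⟩ := h_coinitial hc.1
    obtain rfl : c' = c := hle.antisymm (hc.2 (h_sub hc'))
    exact ⟨c', ⟨hc', lowerBounds_mono_set h_sub hc.2⟩, hc⟩

theorem mainTheorem2 {V : Type*} [Fintype V] [DecidableEq V] (N : DistributionNetwork V)
    (hS : N.S.card = 2) (hT : N.T.Nonempty) (hd : ∀ i ∈ N.S, 0 ≤ N.d i) :
    N.subsetMinCost = N.codedMinCost ∧
    (N.subsetValues.Nonempty ↔ N.codedValues.Nonempty) ∧
    (N.codedValues.Nonempty →
      ∃ fopt : ℝ, IsLeast N.subsetValues fopt ∧ IsLeast N.codedValues fopt) :=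
  mainTheorem2_general N hS hT hd
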